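/- An instance of the all-or-nothing flow problem in trees (ANF-Tree) consists of a tree with edge set $E$, $|E|=m$, with positive edge capacities $u_e$, and a set $R$ of $k$ requests; each $r\in R$ has two distinct end vertices, a demand $d_r\ge 0$ and a profit $w_r\ge 0$. Let $R_e$ be the set of requests whose unique path in the tree uses the edge $e$. A set $T\subseteq R$ is routable if $\sum_{r\in T\cap R_e}d_r\le u_e$ for all $e\in E$, and $\operatorname{rank}(S)$ is the largest size of a routable subset of $S\subseteq R$. For $S\subseteq E$ let $$K(S)=\Big\{x\in[0,1]^R:\ \sum_{r\in R_e}d_rx_r\le u_e\ \text{ for all } e\in S\Big\},\qquad K_I(S)=\operatorname{conv}\big(K(S)\cap\{0,1\}^R\big),$$ let $P_I=K_I(E)$, and for $1\le t\le m$ let $$P^t=\bigcap_{S\subseteq E,\ |S|=t}K_I(S),\qquad P^t_{\operatorname{rank}}=\Big\{x\in P^t:\ \sum_{i\in S}x_i\le\operatorname{rank}(S)\ \text{ for all } S\subseteq R\Big\}.$$ The integrality gap of $Q\in\{P^t,P^t_{\operatorname{rank}}\}$ is $\max\{w^Tx:x\in Q\}/\max\{w^Tx:x\in P_I\}$. For $h\ge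 2$ the Friggstad–Gao instance $T^h_{FG}$ is the following. The tree has a root $r$ (level $0$) with a single child (level $1$); every vertex of level $1,\dots,h-1$ has $2^{h-1}$ children, and the vertices of level $h$ are leaves. An edge between levels $\ell-1$ and $\ell$ has capacity $2^{h(h-\ell+1)}$. Every vertex $v$ of level $\ell\ge 1$ carries one request, between $v$ and $r$, with demand $2^{h(h-\ell+1)}-2^{h(h-\ell)}$ and profit $2^{-(h-1)(\ell-1)}$. Here $k=m=\sum_{i=0}^{h-1}2^{(h-1)i}$. **Theorem.** There is an absolute constant $C>0$ such that the following hold. 1. For every integer $t\ge 1$ there is $h_0$ such that for all $h\ge\max(h_0,2)$ the integrality gap of $P^t_{\operatorname{rank}}$ on $T^h_{FG}$ is at least $C\sqrt{\log k}$. 2. For every real $c>0$ there is $h_0$ such that for all $h\ge\max(h_0,2)$ the integrality gaps of $P^{t}$ and of $P^{t}_{\operatorname{rank}}$ on $T^h_{FG}$, with $t=\min(\lceil k^c\rceil,m)$, are both at least $C/c$. -/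

import Mathlib

/-- An instance of the all-or-nothing flow problem in trees: a tree `graph` on the vertex set `V`
with positive edge capacities, and a family of requests indexed by `R`, each with two distinct end
vertices, a non-negative demand and a non-negative profit. -/
structure ANFTree (V R : Type*) where
  graph : SimpleGraph V
  isTree : graph.IsTree
  capacity : Sym2 V → ℝ
  capacity_pos : ∀ e ∈ graph.edgeSet, 0 < capacity e
  source : R → V
  sink : R → V
  source_ne_sink : ∀ r, source r ≠ sink r
  demand : R → ℝ
  demand_nonneg : ∀ r, 0 ≤ demand r
  profit : R → ℝ
  profit_nonneg : ∀ r, 0 ≤ profit r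

namespace ANFTree

variable {V R : Type*} [Fintype R] (I : ANFTree V R)

/-- The number `k` of requests. -/
def numRequests (_ : ANFTree V R) : ℕ := Fintype.card R

/-- The number `m` of edges. -/
noncomputable def numEdges {V R : Type*} (I : ANFTree V R) : ℕ := I.graph.edgeSet.ncard

/-- The edge `e` lies on the (unique) simple path joining the end vertices of the request `r`. -/
def UsesEdge {V R : Type*} (I : ANFTree V R) (r : R) (e : Sym2 V) : Prop :=
  ∃ p : I.graph.Path (I.source r) (I.sink r), e ∈ p.1.edges

open scoped Classical in
/-- The load `∑_{r ∈ R_e} d_r x_r` that the vector `x` puts on the edge `e`. -/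
noncomputable def load (x : R → ℝ) (e : Sym2 V) : ℝ :=
  ∑ r with I.UsesEdge r e, I.demand r * x r

/-- `K(S)`: the vectors in the cube `[0,1]^R` that respect the capacities of the edges in `S`. -/
def knapsack (S : Set (Sym2 V)) : Set (R → ℝ) :=
  {x | (∀ r, 0 ≤ x r ∧ x r ≤ 1) ∧ ∀ e ∈ S, I.load x e ≤ I.capacity e}

/-- `K_I(S)`: the convex hull of the 0-1 vectors in `K(S)`. -/
def knapsackHull (S : Set (Sym2 V)) : Set (R → ℝ) :=
  convexHull ℝ (I.knapsack S ∩ {x | ∀ r, x r = 0 ∨ x r = 1})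

/-- `P_I`: the convex hull of the 0-1 vectors in the natural relaxation `P = K(E)`. -/
def integerHull : Set (R → ℝ) := I.knapsackHull I.graph.edgeSet

/-- `P^t = ⋂_{|S| = t} K_I(S)`, the `t`-th level of the knapsack intersection hierarchy
(`1 ≤ t ≤ m`); here `S` ranges over the sets of exactly `t` edges of the tree. -/
def level (t : ℕ) : Set (R → ℝ) :=
  {x | ∀ S : Finset (Sym2 V), (S : Set (Sym2 V)) ⊆ I.graph.edgeSet → S.card = t →
    x ∈ I.knapsackHull (S : Set (Sym2 V))}

open scoped Classical in
/-- A set of requests is routable if, on each edge, the total demand of those of its requests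
whose path uses the edge is at most the capacity. -/
def Routable {V R : Type*} (I : ANFTree V R) (T : Finset R) : Prop :=
  ∀ e ∈ I.graph.edgeSet, ∑ r ∈ T with I.UsesEdge r e, I.demand r ≤ I.capacity e

open scoped Classical in
/-- `rank(S)`: the largest number of requests in a routable subset of `S`. -/
noncomputable def rank {V R : Type*} (I : ANFTree V R) (S : Finset R) : ℕ :=
  (S.powerset.filter I.Routable).sup Finset.card

/-- `P^t_rank`: the vectors of `P^t` that satisfy all rank constraints
`∑_{i ∈ S} x_i ≤ rank(S)`. -/
def levelRank (t : ℕ) : Set (R → ℝ) :=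
  I.level t ∩ {x | ∀ S : Finset R, ∑ r ∈ S, x r ≤ (I.rank S : ℝ)}

/-- The integrality gap of a relaxation `Q`: the optimal profit over `Q` divided by the optimal
profit over `P_I`. -/
noncomputable def integralityGap (Q : Set (R → ℝ)) : ℝ :=
  sSup ((fun x => ∑ r, I.profit r * x r) '' Q) /
    sSup ((fun x => ∑ r, I.profit r * x r) '' I.integerHull)

end ANFTree

namespace FriggstadGao

/-- The non-root vertices of `T_FG^h`. The list `[a_j, …, a_1]` of length `j < h` is a vertex of
level `j + 1`; the empty list is the single child of the root, and the children of `l` are the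
lists `a :: l` with `a` one of `2^(h-1)` symbols, as long as the level is at most `h`. -/
abbrev Node (h : ℕ) : Type := {l : List (Fin (2 ^ (h - 1))) // l.length < h}

/-- All vertices of `T_FG^h`; `none` is the root. -/
abbrev Vertex (h : ℕ) : Type := Option (Node h)

noncomputable instance (h : ℕ) : Fintype (Node h) :=
  (List.finite_length_lt (Fin (2 ^ (h - 1))) h).fintype

/-- The parent of a non-root vertex. -/
def parent {h : ℕ} : Node h → Vertex h
  | ⟨[], _⟩ => none
  | ⟨_ :: l, hl⟩ => some ⟨l, Nat.lt_of_succ_lt hl⟩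

/-- The level of a vertex, its distance from the root. -/
def depth {h : ℕ} : Vertex h → ℕ
  | none => 0
  | some n => n.1.length + 1

theorem depth_parent {h : ℕ} (n : Node h) : depth (some n) = depth (parent n) + 1 := by
  rcases n with ⟨_ | ⟨a, l⟩, hl⟩ <;> simp [depth, parent]

theorem some_ne_parent {h : ℕ} (n : Node h) : some n ≠ parent n := by
  intro H
  have h1 := depth_parent n
  rw [← H] at h1
  omega

/-- The tree `T_FG^h`: every non-root vertex is joined to its parent. -/
def tree (h : ℕ) : SimpleGraph (Vertex h) :=
  SimpleGraph.fromRel fun u v => ∃ n : Node h, u = some n ∧ v = parent n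

theorem tree_adj_parent {h : ℕ} (n : Node h) : (tree h).Adj (some n) (parent n) :=
  (SimpleGraph.fromRel_adj _ _ _).2 ⟨some_ne_parent n, Or.inl ⟨n, rfl, rfl⟩⟩

theorem tree_reachable_root {h : ℕ} :
    ∀ (l : List (Fin (2 ^ (h - 1)))) (hl : l.length < h), (tree h).Reachable (some ⟨l, hl⟩) none
  | [], hl => (tree_adj_parent ⟨[], hl⟩).reachable
  | a :: l, hl => (tree_adj_parent ⟨a :: l, hl⟩).reachable.trans
      (tree_reachable_root l (Nat.lt_of_succ_lt hl))

theorem tree_edgeSet (h : ℕ) :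
    (tree h).edgeSet = Set.range fun n : Node h => s(some n, parent n) := by
  ext e
  induction e using Sym2.ind with
  | _ u v =>
    simp only [SimpleGraph.mem_edgeSet, Set.mem_range]
    constructor
    · intro H
      rcases ((SimpleGraph.fromRel_adj _ _ _).1 H).2 with ⟨n, rfl, rfl⟩ | ⟨n, rfl, rfl⟩
      · exact ⟨n, rfl⟩
      · exact ⟨n, Sym2.eq_swap⟩
    · rintro ⟨n, hn⟩
      rw [← SimpleGraph.mem_edgeSet, ← hn]
      exact tree_adj_parent n

theorem edge_injective (h : ℕ) :
    Function.Injective fun n : Node h => s(some n, parent n) := by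
  intro n n' H
  rcases Sym2.eq_iff.1 H with ⟨h1, _⟩ | ⟨h1, h2⟩
  · exact Option.some.inj h1
  · have h3 := depth_parent n
    have h4 := depth_parent n'
    rw [h1, h2] at h3
    omega

theorem isTree (h : ℕ) : (tree h).IsTree := by
  rw [SimpleGraph.isTree_iff_connected_and_card]
  constructor
  · have hr : ∀ v : Vertex h, (tree h).Reachable v none
      | none => SimpleGraph.Reachable.refl _
      | some ⟨l, hl⟩ => tree_reachable_root l hl
    exact ⟨fun u v => (hr u).trans (hr v).symm⟩
  · rw [tree_edgeSet, Nat.card_range_of_injective (edge_injective h), Finite.card_option]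

/-- The Friggstad–Gao instance `T_FG^h`. The edge joining levels `ℓ - 1` and `ℓ` has capacity
`2^(h(h-ℓ+1))`. Each vertex of level `ℓ ≥ 1` carries one request, from that vertex to the root,
with demand `2^(h(h-ℓ+1)) - 2^(h(h-ℓ))` and profit `2^(-(h-1)(ℓ-1))`. -/
noncomputable def inst (h : ℕ) : ANFTree (Vertex h) (Node h) where
  graph := tree h
  isTree := isTree h
  capacity := Sym2.lift ⟨fun u v => (2 : ℝ) ^ (h * (h + 1 - max (depth u) (depth v))),
    fun u v => by dsimp only; rw [max_comm]⟩
  capacity_pos := by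
    intro e _
    induction e using Sym2.ind with
    | _ u v => simp only [Sym2.lift_mk]; positivity
  source n := some n
  sink _ := none
  source_ne_sink _ := Option.some_ne_none _
  demand n := 2 ^ (h * (h + 1 - depth (some n))) - 2 ^ (h * (h - depth (some n)))
  demand_nonneg n := sub_nonneg.2 <| pow_le_pow_right₀ one_le_two <|
    Nat.mul_le_mul_left _ (by omega)
  profit n := ((2 : ℝ) ^ ((h - 1) * (depth (some n) - 1)))⁻¹
  profit_nonneg n := by positivity

end FriggstadGao

/-!
The profits of each level of the tree add up to `1`, so a constant vector `1 / (q + 1)` has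
profit `h / (q + 1)`. This vector lies in the relaxations, while integral solutions have profit at
most `2`.

*Integral solutions* (`profit_le_two_of_mem_integerHull`). Profit per unit of demand roughly doubles
from each level to the next, and is calibrated so that the capacity which a selected request leaves on
its edge is worth at most the profit of that request. As the profit of a node equals that of all
its children, induction from the leaves bounds the profit inside the subtree of a node by twice
the profit of the node.

*The relaxation `P^t`* (`const_mem_level`). All requests strictly below a node fit together on its
edge (`sum_children_subtreeSum_le`), so an edge is overloaded only if its own request is selected.
Given `t` edges `S`, the requests outside `S` are therefore feasible together. The requests of `S`
are split by level modulo `q`: a selected request leaves a capacity that exceeds by at least a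
factor `2 ^ (h * (q - 1))` the demand of any selected request below it, as the latter is at least `q`
levels deeper. So for `t ≤ 2 ^ (h * (q - 1))` the constant vector is the average of `q + 1`
feasible 0-1 vectors.

*Rank constraints* (`card_le_three_mul_rank`). For `h ≥ 4` every set of requests has a routable
subset of at least a third of its size, so that `1 / (q + 1)` with `q ≥ 2` satisfies them.

For fixed `t`, `q = 2` gives a gap of order `h`, which is at least `√(log k)` as `k ≤ 2 ^ (h * h)`
(`card_node_le`). For `t = k ^ c`, a value `q` of about `c * h` gives a gap of order `1 / c`.
-/

namespace FriggstadGao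

open Finset

variable {h : ℕ}

/-! ### Capacities, demands and profits -/

/-- The capacity of the edge above a node given by a list of length `j`; it is also defined
for `j = h`, where it is the residual capacity `1` that a leaf request leaves on its edge. -/
noncomputable def cap (h j : ℕ) : ℝ := 2 ^ (h * (h - j))

theorem cap_pos (h j : ℕ) : 0 < cap h j := by unfold cap; positivity

theorem cap_eq {j : ℕ} (hj : j < h) : cap h j = 2 ^ h * cap h (j + 1) := by
  unfold cap
  rw [← pow_add]
  congr 1
  obtain ⟨m, rfl⟩ := Nat.exists_eq_add_of_lt hj
  rw [show j + m + 1 - j = m + 1 by omega, show j + m + 1 - (j + 1) = m by omega]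
  ring

theorem cap_anti {i j : ℕ} (hij : i ≤ j) : cap h j ≤ cap h i :=
  pow_le_pow_right₀ one_le_two (Nat.mul_le_mul_left _ (by omega))

theorem pow_mul_cap {j q : ℕ} (hq : 1 ≤ q) (hj : j + q ≤ h) :
    2 ^ (h * (q - 1)) * cap h (j + q) = cap h (j + 1) := by
  unfold cap
  rw [← pow_add, ← Nat.mul_add]
  congr 2
  omega

theorem demand_eq (n : Node h) :
    (inst h).demand n = cap h n.1.length - cap h (n.1.length + 1) := by
  simp only [inst, depth, cap, Nat.add_sub_add_right]

theorem demand_le_cap (n : Node h) : (inst h).demand n ≤ cap h n.1.length := by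
  rw [demand_eq]
  linarith [cap_pos h (n.1.length + 1)]

theorem cap_le_two_mul_demand (n : Node h) : cap h n.1.length ≤ 2 * (inst h).demand n := by
  rw [demand_eq, cap_eq n.2]
  have h1 : (2 : ℝ) ^ 1 ≤ 2 ^ h := pow_le_pow_right₀ one_le_two (by have := n.2; omega)
  nlinarith [cap_pos h (n.1.length + 1)]

theorem profit_eq (n : Node h) :
    (inst h).profit n = ((2 : ℝ) ^ ((h - 1) * n.1.length))⁻¹ := by
  simp [inst, depth]

theorem capacity_edge (n : Node h) :
    (inst h).capacity s(some n, parent n) = cap h n.1.length := by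
  have := depth_parent n
  simp only [inst, Sym2.lift_mk, cap]
  rw [max_eq_left (by omega)]
  simp [depth]

/-! ### Paths to the root -/

theorem exists_path_root : ∀ (l : List (Fin (2 ^ (h - 1)))) (hl : l.length < h),
    ∃ p : (tree h).Walk (some ⟨l, hl⟩) none, p.IsPath ∧
      (∀ v ∈ p.support, depth v ≤ l.length + 1) ∧
      ∀ n : Node h, s(some n, parent n) ∈ p.edges ↔ n.1 <:+ l
  | [], hl => by
    have hadj : (tree h).Adj (some ⟨[], hl⟩) none := tree_adj_parent ⟨[], hl⟩
    refine ⟨.cons hadj .nil, ?_, ?_, ?_⟩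
    · simp [SimpleGraph.Walk.cons_isPath_iff]
    · simp [depth]
    · intro n
      rw [SimpleGraph.Walk.edges_cons, List.mem_cons,
        show s(some ⟨[], hl⟩, none) = s(some ⟨[], hl⟩, parent ⟨[], hl⟩) from rfl,
        (edge_injective h).eq_iff]
      simp [Subtype.ext_iff]
  | a :: l, hl => by
    obtain ⟨p, hp, hd, he⟩ := exists_path_root l (Nat.lt_of_succ_lt hl)
    have hadj : (tree h).Adj (some ⟨a :: l, hl⟩) (some ⟨l, Nat.lt_of_succ_lt hl⟩) :=
      tree_adj_parent ⟨a :: l, hl⟩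
    refine ⟨.cons hadj p, ?_, ?_, ?_⟩
    · refine hp.cons fun H => ?_
      have := hd _ H
      simp [depth] at this
    · intro v hv
      rw [SimpleGraph.Walk.support_cons, List.mem_cons] at hv
      rcases hv with rfl | hv
      · simp [depth]
      · have := hd v hv
        simp only [List.length_cons]
        omega
    · intro n
      rw [SimpleGraph.Walk.edges_cons, List.mem_cons,
        show s(some ⟨a :: l, hl⟩, some ⟨l, Nat.lt_of_succ_lt hl⟩) =
          s(some ⟨a :: l, hl⟩, parent ⟨a :: l, hl⟩) from rfl,
        (edge_injective h).eq_iff, he, List.suffix_cons_iff]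
      simp [Subtype.ext_iff]

/-- Ancestors are suffixes, and the request of `r` uses exactly the edges above `r` and its
ancestors. -/
theorem usesEdge_iff (r n : Node h) :
    (inst h).UsesEdge r s(some n, parent n) ↔ n.1 <:+ r.1 := by
  obtain ⟨p, hp, -, he⟩ := exists_path_root r.1 r.2
  constructor
  · rintro ⟨p', hp'⟩
    have := (isTree h).isAcyclic.subsingleton_path (some r) none
    rw [Subsingleton.elim (α := (tree h).Path (some r) none) p' ⟨p, hp⟩] at hp'
    exact (he n).1 hp'
  · exact fun H => ⟨⟨p, hp⟩, (he n).2 H⟩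

/-! ### Sums over subtrees -/

/-- The sum of `g` over the subtree below the list `l`, including `l` itself. Lists of length
at least `h` are allowed and give the empty sum. -/
noncomputable def subtreeSum (g : Node h → ℝ) (l : List (Fin (2 ^ (h - 1)))) : ℝ :=
  ∑ r with l <:+ r.1, g r

theorem subtreeSum_of_le (g : Node h → ℝ) {l : List (Fin (2 ^ (h - 1)))} (hl : h ≤ l.length) :
    subtreeSum g l = 0 := by
  unfold subtreeSum
  rw [Finset.filter_false_of_mem, sum_empty]
  intro r _ H
  have := H.length_le
  have := r.2
  omega

theorem subtreeSum_nil (g : Node h → ℝ) : subtreeSum g [] = ∑ r, g r := by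
  simp [subtreeSum]

theorem subtreeSum_mono {g g' : Node h → ℝ} (H : ∀ r, g r ≤ g' r)
    (l : List (Fin (2 ^ (h - 1)))) : subtreeSum g l ≤ subtreeSum g' l :=
  sum_le_sum fun r _ => H r

theorem subtreeSum_const_mul (K : ℝ) (g : Node h → ℝ) (l : List (Fin (2 ^ (h - 1)))) :
    subtreeSum (fun r => K * g r) l = K * subtreeSum g l :=
  (mul_sum ..).symm

theorem subtreeSum_eq_add_children (g : Node h → ℝ) (n : Node h) :
    subtreeSum g n.1 = g n + ∑ a, subtreeSum g (a :: n.1) := by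
  unfold subtreeSum
  simp only [sum_filter]
  rw [sum_comm]
  have h1 : g n = ∑ r, if r = n then g r else 0 := by simp
  rw [h1, ← sum_add_distrib]
  refine sum_congr rfl fun r _ => ?_
  by_cases hr : r = n
  · subst hr
    have h2 : ∀ a, ¬ a :: r.1 <:+ r.1 := fun a H => by
      have := H.length_le
      simp at this
    simp [h2]
  by_cases hs : n.1 <:+ r.1
  · obtain ⟨t, ht⟩ := hs
    rcases List.eq_nil_or_concat t with rfl | ⟨t', a, rfl⟩
    · exact absurd (Subtype.ext ht).symm hr
    · have h2 : ∀ b, b :: n.1 <:+ r.1 ↔ b = a := by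
        have h3 : a :: n.1 <:+ r.1 := ⟨t', by simpa using ht⟩
        refine fun b => ⟨fun H => ?_, fun H => H ▸ h3⟩
        have := (List.suffix_of_suffix_length_le H h3 (by simp)).eq_of_length (by simp)
        simpa using this
      have h4 : n.1 <:+ r.1 := ⟨_, ht⟩
      simp [h2, h4, hr]
  · have h2 : ∀ a, ¬ a :: n.1 <:+ r.1 := fun a H => hs ((List.suffix_cons a n.1).trans H)
    simp [h2, hs, hr]

/-- Induction from the leaves upwards, over lists of any length; those of length at least `h`
are the base case. -/
theorem leaf_induction {P : List (Fin (2 ^ (h - 1))) → Prop}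
    (base : ∀ l, h ≤ l.length → P l)
    (step : ∀ n : Node h, (∀ a, P (a :: n.1)) → P n.1) (l : List (Fin (2 ^ (h - 1)))) : P l := by
  by_cases hl : h ≤ l.length
  · exact base l hl
  · exact step ⟨l, not_le.1 hl⟩ fun a => leaf_induction base step (a :: l)
termination_by h - l.length
decreasing_by simp only [List.length_cons]; omega

theorem sum_children_le {f : Fin (2 ^ (h - 1)) → ℝ} {B : ℝ} (H : ∀ a, f a ≤ B) :
    ∑ a, f a ≤ 2 ^ (h - 1) * B := by
  refine (sum_le_card_nsmul _ _ B fun a _ => H a).trans_eq ?_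
  simp

theorem two_pow_pred_mul_cap (n : Node h) :
    2 ^ (h - 1) * (2 * cap h (n.1.length + 1)) = cap h n.1.length := by
  rw [cap_eq n.2, ← mul_assoc, ← pow_succ, Nat.sub_add_cancel (by have := n.2; omega)]

theorem subtreeSum_cap_le (l : List (Fin (2 ^ (h - 1)))) :
    subtreeSum (fun r : Node h => cap h r.1.length) l ≤ 2 * cap h l.length := by
  induction l using leaf_induction with
  | base l hl =>
    rw [subtreeSum_of_le _ hl]
    linarith [cap_pos h l.length]
  | step n ih =>
    rw [subtreeSum_eq_add_children]
    simp only [List.length_cons] at ih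
    have := sum_children_le ih
    linarith [two_pow_pred_mul_cap n]

/-- All requests strictly below a node fit together on the edge above it: demands are less than
capacities, and the capacities in a subtree add up, level by level, to half of the previous total. -/
theorem sum_children_subtreeSum_le {g : Node h → ℝ} (hg : ∀ r, g r ≤ cap h r.1.length)
    (n : Node h) : ∑ a, subtreeSum g (a :: n.1) ≤ cap h n.1.length := by
  rw [← two_pow_pred_mul_cap n]
  exact sum_children_le fun a =>
    (subtreeSum_mono hg _).trans ((subtreeSum_cap_le _).trans_eq (by simp))

/-! ### Loads of sets of requests -/

open scoped Classical in
/-- The 0-1 vector of a set of requests. -/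
noncomputable def ind (T : Set (Node h)) (r : Node h) : ℝ := if r ∈ T then 1 else 0

theorem ind_nonneg (T : Set (Node h)) (r : Node h) : 0 ≤ ind T r := by
  unfold ind; split_ifs <;> norm_num

theorem ind_le_one (T : Set (Node h)) (r : Node h) : ind T r ≤ 1 := by
  unfold ind; split_ifs <;> norm_num

theorem load_edge (x : Node h → ℝ) (n : Node h) :
    (inst h).load x s(some n, parent n) =
      subtreeSum (fun r => (inst h).demand r * x r) n.1 := by
  unfold ANFTree.load subtreeSum
  refine sum_congr ?_ fun _ _ => rfl
  ext r
  simp only [mem_filter, mem_univ, true_and, usesEdge_iff]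

theorem demand_mul_ind_le (T : Set (Node h)) (r : Node h) :
    (inst h).demand r * ind T r ≤ cap h r.1.length :=
  (mul_le_of_le_one_right ((inst h).demand_nonneg r) (ind_le_one T r)).trans (demand_le_cap r)

theorem load_ind_le_of_notMem {T : Set (Node h)} {n : Node h} (hn : n ∉ T) :
    (inst h).load (ind T) s(some n, parent n) ≤ (inst h).capacity s(some n, parent n) := by
  rw [load_edge, capacity_edge, subtreeSum_eq_add_children]
  have h1 : ind T n = 0 := if_neg hn
  rw [h1, mul_zero, zero_add]
  exact sum_children_subtreeSum_le (demand_mul_ind_le T) n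

/-- If `n` is selected and the selected requests strictly below `n` are few and at least `q`
levels deeper, then they fit into the capacity that `n` leaves. -/
theorem load_ind_le_of_mem {T : Finset (Node h)} {q : ℕ} (hq : 1 ≤ q) {n : Node h}
    (hT : ∀ r ∈ T, n.1 <:+ r.1 → r ≠ n → n.1.length + q ≤ r.1.length)
    (hc : #{r ∈ T | n.1 <:+ r.1 ∧ r ≠ n} ≤ 2 ^ (h * (q - 1))) :
    (inst h).load (ind (T : Set (Node h))) s(some n, parent n) ≤
      (inst h).capacity s(some n, parent n) := by
  rw [load_edge, capacity_edge]
  have h1 : subtreeSum (fun r => (inst h).demand r * ind (T : Set (Node h)) r) n.1 ≤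
      (inst h).demand n + ∑ r ∈ T with n.1 <:+ r.1 ∧ r ≠ n, (inst h).demand r := by
    have h2 : (inst h).demand n = ∑ r, if r = n then (inst h).demand r else 0 := by simp
    have h3 : ∑ r ∈ T with n.1 <:+ r.1 ∧ r ≠ n, (inst h).demand r =
        ∑ r, if r ∈ T ∧ n.1 <:+ r.1 ∧ r ≠ n then (inst h).demand r else 0 := by
      rw [← sum_filter]
      refine sum_congr ?_ fun _ _ => rfl
      ext r
      simp
    rw [h2, h3, ← sum_add_distrib, subtreeSum, sum_filter]
    refine sum_le_sum fun r _ => ?_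
    have := (inst h).demand_nonneg r
    simp only [ind, mem_coe]
    by_cases c : r = n
    · subst c
      by_cases b : r ∈ T <;> simp [b, this]
    · by_cases a : n.1 <:+ r.1 <;> by_cases b : r ∈ T <;> simp [a, b, c]
  refine h1.trans ?_
  suffices H : ∑ r ∈ T with n.1 <:+ r.1 ∧ r ≠ n, (inst h).demand r ≤ cap h (n.1.length + 1) by
    rw [demand_eq n]
    linarith
  rcases eq_empty_or_nonempty {r ∈ T | n.1 <:+ r.1 ∧ r ≠ n} with he | ⟨r₀, hr₀⟩
  · rw [he, sum_empty]
    exact (cap_pos _ _).le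
  · have hlen : ∀ r ∈ ({r ∈ T | n.1 <:+ r.1 ∧ r ≠ n} : Finset (Node h)),
        n.1.length + q ≤ r.1.length := fun r hr => by
      rw [mem_filter] at hr
      exact hT r hr.1 hr.2.1 hr.2.2
    have hqh : n.1.length + q ≤ h := (hlen r₀ hr₀).trans r₀.2.le
    rw [← pow_mul_cap hq hqh]
    refine (sum_le_card_nsmul _ _ _ fun r hr =>
      (demand_le_cap r).trans (cap_anti (hlen r hr))).trans ?_
    rw [nsmul_eq_mul]
    refine mul_le_mul_of_nonneg_right ?_ (cap_pos _ _).le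
    exact_mod_cast hc

theorem add_le_length_of_mod_eq {q : ℕ} {n r : Node h} (hs : n.1 <:+ r.1) (hr : r ≠ n)
    (hm : r.1.length % q = n.1.length % q) : n.1.length + q ≤ r.1.length := by
  have h1 : n.1.length < r.1.length :=
    lt_of_le_of_ne hs.length_le fun H => hr (Subtype.ext (hs.eq_of_length H)).symm
  have h2 : q ∣ r.1.length - n.1.length := (Nat.modEq_iff_dvd' h1.le).1 hm.symm
  have := Nat.le_of_dvd (by omega) h2
  omega

/-- A set of requests whose levels agree modulo `q` respects every capacity, provided that no
selected request has too many selected ones below it. -/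
theorem load_ind_le_of_mod_eq {T : Finset (Node h)} {q i : ℕ} (hq : 1 ≤ q)
    (hT : ∀ r ∈ T, r.1.length % q = i)
    (hc : ∀ n ∈ T, #{r ∈ T | n.1 <:+ r.1 ∧ r ≠ n} ≤ 2 ^ (h * (q - 1))) (n : Node h) :
    (inst h).load (ind (T : Set (Node h))) s(some n, parent n) ≤
      (inst h).capacity s(some n, parent n) := by
  by_cases hn : n ∈ T
  · exact load_ind_le_of_mem hq
      (fun r hr hs hne => add_le_length_of_mod_eq hs hne ((hT r hr).trans (hT n hn).symm))
      (hc n hn)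
  · exact load_ind_le_of_notMem (by simpa using hn)

theorem ind_mem_knapsackHull {T : Set (Node h)} {S : Set (Sym2 (Vertex h))}
    (hT : ∀ e ∈ S, (inst h).load (ind T) e ≤ (inst h).capacity e) :
    ind T ∈ (inst h).knapsackHull S :=
  subset_convexHull ℝ _ ⟨⟨fun r => ⟨ind_nonneg T r, ind_le_one T r⟩, hT⟩, fun r => by
    by_cases hr : r ∈ T <;> simp [ind, hr]⟩

/-! ### The constant vector in the relaxations -/

/-- The constant vector is the average of `q + 1` feasible 0-1 vectors: for `i < q`, the requests
whose edge is in `S` and whose level is `i` modulo `q`; and the requests whose edge is not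
in `S`. -/
theorem const_mem_level {q t : ℕ} (hq : 1 ≤ q) (ht : t ≤ 2 ^ (h * (q - 1))) :
    (fun _ => 1 / ((q : ℝ) + 1)) ∈ (inst h).level t := by
  classical
  intro S hS hcard
  set A : Finset (Node h) := {n | s(some n, parent n) ∈ S} with hA
  have hAc : #A ≤ t := by
    rw [← hcard]
    exact card_le_card_of_injOn (fun n => s(some n, parent n)) (by intro n; simp [hA])
      (edge_injective h).injOn
  let χ : Node h → ℕ := fun r => if r ∈ A then r.1.length % q else q
  have hχ : ∀ r, χ r ∈ range (q + 1) := fun r => by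
    have := Nat.mod_lt r.1.length hq
    simp only [χ, mem_range]
    split_ifs <;> omega
  have key : ∀ i ∈ range (q + 1), ind {r | χ r = i} ∈ (inst h).knapsackHull (S : Set _) := by
    intro i hi
    refine ind_mem_knapsackHull fun e he => ?_
    obtain ⟨n, rfl⟩ : e ∈ Set.range fun n : Node h => s(some n, parent n) := by
      rw [← tree_edgeSet]
      exact hS he
    have hnA : n ∈ A := by simpa [hA] using he
    rcases (Nat.lt_succ_iff_lt_or_eq.1 (mem_range.1 hi)) with hi | rfl
    · have h1 : ∀ r, χ r = i ↔ r ∈ A ∧ r.1.length % q = i := fun r => by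
        by_cases hr : r ∈ A <;> simp [χ, hr]
        omega
      have h2 : {r | χ r = i} = ((A.filter fun r => r.1.length % q = i : Finset _) : Set _) := by
        ext r
        simp [h1]
      rw [h2]
      refine load_ind_le_of_mod_eq hq (i := i) (fun r hr => (mem_filter.1 hr).2) (fun m _ => ?_) n
      exact (card_le_card ((filter_subset _ _).trans (filter_subset _ _))).trans (hAc.trans ht)
    · refine load_ind_le_of_notMem ?_
      have := Nat.mod_lt n.1.length hq
      simp only [χ, Set.mem_ofPred_eq, if_pos hnA]
      omega
  have hsum := (convex_convexHull ℝ _).sum_mem (t := range (q + 1))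
    (w := fun _ => 1 / ((q : ℝ) + 1)) (fun _ _ => by positivity)
    (by simp; field_simp) key
  refine (congrArg (· ∈ (inst h).knapsackHull (S : Set _)) ?_).mpr hsum
  ext r
  rw [Finset.sum_apply]
  simp only [Pi.smul_apply, smul_eq_mul, ← mul_sum]
  have : ∑ i ∈ range (q + 1), ind {r | χ r = i} r = 1 := by
    rw [sum_eq_single (χ r)]
    · simp [ind]
    · intro i _ hi
      simp [ind, hi.symm]
    · exact fun H => absurd (hχ r) H
  rw [this, mul_one]

theorem card_suffixes_le (S : Finset (Node h)) (r : Node h) : #{n ∈ S | n.1 <:+ r.1} ≤ h := by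
  have : #{n ∈ S | n.1 <:+ r.1} ≤ #(range h) := by
    refine card_le_card_of_injOn (fun n => n.1.length) (fun n _ => by simpa using n.2) ?_
    intro n hn n' hn' H
    simp only [coe_filter, Set.mem_ofPred_eq] at hn hn'
    exact Subtype.ext
      ((List.suffix_of_suffix_length_le hn.2 hn'.2 H.le).eq_of_length H)
  simpa using this

theorem routable_of_load {T : Finset (Node h)}
    (hT : ∀ n, (inst h).load (ind (T : Set (Node h))) s(some n, parent n) ≤
      (inst h).capacity s(some n, parent n)) : (inst h).Routable T := by
  classical
  intro e he
  obtain ⟨n, rfl⟩ : e ∈ Set.range fun n : Node h => s(some n, parent n) := by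
    rw [← tree_edgeSet]
    exact he
  refine le_of_eq_of_le ?_ (hT n)
  simp only [ANFTree.load, ind, mem_coe, mul_ite, mul_one, mul_zero]
  rw [← sum_filter, filter_filter]
  refine sum_congr ?_ fun _ _ => rfl
  ext r
  simp [and_comm]

theorem card_le_rank {S T : Finset (Node h)} (hTS : T ⊆ S) (hT : (inst h).Routable T) :
    #T ≤ (inst h).rank S := by
  classical
  unfold ANFTree.rank
  exact le_sup (f := card) (mem_filter.2 ⟨mem_powerset.2 hTS, hT⟩)

theorem four_mul_le_two_pow {n : ℕ} (hn : 4 ≤ n) : n * 4 ≤ 2 ^ n := by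
  induction n, hn using Nat.le_induction with
  | base => norm_num
  | succ m hm ih => rw [pow_succ]; omega

/-- Every set of requests has a routable subset of at least a third of its size. Call a member
of `S` light if at most `2 ^ h` others lie below it. As a request has at most `h` ancestors, all
but a fraction `h / 2 ^ h` of the members are light, and the light ones of either parity of
levels form a routable set. -/
theorem card_le_three_mul_rank (hh : 4 ≤ h) (S : Finset (Node h)) :
    #S ≤ 3 * (inst h).rank S := by
  classical
  let D : Node h → ℕ := fun n => #{r ∈ S | n.1 <:+ r.1 ∧ r ≠ n}
  set H := S.filter fun n => ¬ D n ≤ 2 ^ h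
  set L := S.filter fun n => D n ≤ 2 ^ h
  have hLH : #L + #H = #S := card_filter_add_card_filter_not _
  have hheavy : #H * 2 ^ h ≤ #S * h := calc
    #H * 2 ^ h ≤ ∑ n ∈ H, D n := by
      rw [← smul_eq_mul]
      refine card_nsmul_le_sum _ _ _ fun n hn => ?_
      have := (mem_filter.1 hn).2
      omega
    _ ≤ ∑ n ∈ S, #{r ∈ S | n.1 <:+ r.1} :=
      (sum_le_sum_of_subset (filter_subset _ _)).trans <| sum_le_sum fun n _ =>
        card_le_card (monotone_filter_right _ fun r _ hr => hr.1)
    _ = ∑ r ∈ S, #{n ∈ S | n.1 <:+ r.1} := sum_card_bipartiteAbove_eq_sum_card_bipartiteBelow _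
    _ ≤ #S * h := by
      rw [← smul_eq_mul]
      exact sum_le_card_nsmul _ _ _ fun r _ => card_suffixes_le S r
  have hpow : h * 4 ≤ 2 ^ h := four_mul_le_two_pow hh
  have hH4 : #H * 4 ≤ #S := by
    have hpos : 0 < h := by omega
    refine Nat.le_of_mul_le_mul_right ?_ hpos
    calc #H * 4 * h = #H * (h * 4) := by ring
      _ ≤ #H * 2 ^ h := Nat.mul_le_mul_left _ hpow
      _ ≤ #S * h := hheavy
  have hpar : ∀ i, #(L.filter fun n => n.1.length % 2 = i) ≤ (inst h).rank S := fun i => by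
    refine card_le_rank ((filter_subset _ _).trans (filter_subset _ _)) (routable_of_load ?_)
    refine load_ind_le_of_mod_eq (q := 2) (i := i) (by norm_num)
      (fun r hr => (mem_filter.1 hr).2) fun n hn => ?_
    have h1 : D n ≤ 2 ^ h := (mem_filter.1 (mem_filter.1 hn).1).2
    refine le_trans (card_le_card ?_) (h1.trans_eq (by simp))
    exact filter_subset_filter _ ((filter_subset _ _).trans (filter_subset _ _))
  have hsplit : #(L.filter fun n => n.1.length % 2 = 0) +
      #(L.filter fun n => n.1.length % 2 = 1) = #L := by
    rw [← card_filter_add_card_filter_not (s := L) fun n => n.1.length % 2 = 0]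
    congr 2
    ext n
    simp
  have h0 := hpar 0
  have h1 := hpar 1
  omega

theorem const_mem_levelRank (hh : 4 ≤ h) {q t : ℕ} (hq : 2 ≤ q) (ht : t ≤ 2 ^ (h * (q - 1))) :
    (fun _ => 1 / ((q : ℝ) + 1)) ∈ (inst h).levelRank t := by
  refine ⟨const_mem_level (by omega) ht, fun S => ?_⟩
  rw [sum_const, nsmul_eq_mul, mul_one_div]
  have hq' : (2 : ℝ) ≤ q := by exact_mod_cast hq
  rw [div_le_iff₀ (by positivity)]
  have h1 : (#S : ℝ) ≤ 3 * (inst h).rank S := by exact_mod_cast card_le_three_mul_rank hh S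
  nlinarith [Nat.cast_nonneg (α := ℝ) ((inst h).rank S)]

/-! ### Integral solutions -/

/-- The profit of a node is the total profit of its children. -/
theorem two_pow_pred_mul_profit (j : ℕ) :
    (2 : ℝ) ^ (h - 1) * ((2 : ℝ) ^ ((h - 1) * (j + 1)))⁻¹ = ((2 : ℝ) ^ ((h - 1) * j))⁻¹ := by
  rw [Nat.mul_succ, pow_add]
  field_simp

theorem subtreeSum_profit {l : List (Fin (2 ^ (h - 1)))} (hl : l.length ≤ h) :
    subtreeSum (inst h).profit l = ((h : ℝ) - l.length) * ((2 : ℝ) ^ ((h - 1) * l.length))⁻¹ := by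
  revert hl
  induction l using leaf_induction with
  | base l hl =>
    intro hl'
    rw [subtreeSum_of_le _ hl, le_antisymm hl' hl, sub_self, zero_mul]
  | step n ih =>
    intro _
    rw [subtreeSum_eq_add_children, sum_congr rfl fun a _ => ih a n.2]
    simp only [List.length_cons, sum_const, card_univ, Fintype.card_fin, nsmul_eq_mul]
    rw [profit_eq, ← two_pow_pred_mul_profit]
    push_cast
    ring

theorem sum_profit (h : ℕ) : ∑ r, (inst h).profit r = h := by
  rw [← subtreeSum_nil, subtreeSum_profit (by simp)]
  simp

theorem profit_le_demand (n : Node h) :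
    (inst h).profit n ≤ 2 ^ h / 2 ^ (h * h) * (inst h).demand n := by
  have hj := n.2
  have h1 : (inst h).profit n ≤ 2 ^ (h - 1) / 2 ^ (h * h) * cap h n.1.length := by
    rw [profit_eq, cap, div_mul_eq_mul_div, inv_eq_one_div,
      div_le_div_iff₀ (by positivity) (by positivity), one_mul, ← pow_add, ← pow_add]
    refine pow_le_pow_right₀ one_le_two ?_
    generalize n.1.length = j at hj
    obtain ⟨m, rfl⟩ := Nat.exists_eq_add_of_lt hj
    rw [show j + m + 1 - j = m + 1 by omega, show j + m + 1 - 1 = j + m by omega]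
    nlinarith
  refine h1.trans ?_
  have h2 : (2 : ℝ) ^ h = 2 ^ (h - 1) * 2 := by
    rw [← pow_succ, Nat.sub_add_cancel (by have := n.2; omega)]
  rw [h2, mul_div_right_comm, mul_assoc]
  exact mul_le_mul_of_nonneg_left (cap_le_two_mul_demand n) (by positivity)

theorem residual_profit_le (n : Node h) :
    2 ^ h / 2 ^ (h * h) * cap h (n.1.length + 1) ≤ ((2 : ℝ) ^ ((h - 1) * n.1.length))⁻¹ := by
  have hj := n.2
  rw [cap, div_mul_eq_mul_div, inv_eq_one_div,
    div_le_div_iff₀ (by positivity) (by positivity), one_mul, ← pow_add, ← pow_add]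
  refine pow_le_pow_right₀ one_le_two ?_
  generalize n.1.length = j at hj
  obtain ⟨m, rfl⟩ := Nat.exists_eq_add_of_lt hj
  rw [show j + m + 1 - (j + 1) = m by omega, show j + m + 1 - 1 = j + m by omega]
  nlinarith

/-- A feasible 0-1 vector collects at most twice the profit of `l` in the subtree of `l`. If `l`
is selected, the residual capacity below it is worth at most its own profit. -/
theorem subtreeSum_profit_mul_le {x : Node h → ℝ} (hx : ∀ r, x r = 0 ∨ x r = 1)
    (hc : ∀ n, (inst h).load x s(some n, parent n) ≤ (inst h).capacity s(some n, parent n))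
    (l : List (Fin (2 ^ (h - 1)))) :
    subtreeSum (fun r => (inst h).profit r * x r) l ≤ 2 * ((2 : ℝ) ^ ((h - 1) * l.length))⁻¹ := by
  induction l using leaf_induction with
  | base l hl =>
    rw [subtreeSum_of_le _ hl]
    positivity
  | step n ih =>
    rw [subtreeSum_eq_add_children]
    rcases hx n with h0 | h1
    · simp only [List.length_cons] at ih
      have h2 := sum_children_le ih
      rw [h0, mul_zero, zero_add]
      refine h2.trans_eq ?_
      rw [mul_left_comm, two_pow_pred_mul_profit]
    · have h2 := hc n
      rw [load_edge, capacity_edge, subtreeSum_eq_add_children, h1, mul_one, demand_eq] at h2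
      have h3 : ∑ a, subtreeSum (fun r => (inst h).profit r * x r) (a :: n.1) ≤
          2 ^ h / 2 ^ (h * h) *
            ∑ a, subtreeSum (fun r => (inst h).demand r * x r) (a :: n.1) := by
        rw [mul_sum]
        refine sum_le_sum fun a _ => ?_
        rw [← subtreeSum_const_mul]
        refine subtreeSum_mono (fun r => ?_) _
        rw [← mul_assoc]
        refine mul_le_mul_of_nonneg_right (profit_le_demand r) ?_
        rcases hx r with h | h <;> simp [h]
      have h4 : (2 : ℝ) ^ h / 2 ^ (h * h) *
          ∑ a, subtreeSum (fun r => (inst h).demand r * x r) (a :: n.1) ≤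
          2 ^ h / 2 ^ (h * h) * cap h (n.1.length + 1) :=
        mul_le_mul_of_nonneg_left (by linarith) (by positivity)
      have h5 := residual_profit_le n
      rw [h1, mul_one, profit_eq]
      linarith

theorem profit_le_two_of_mem_integerHull {x : Node h → ℝ} (hx : x ∈ (inst h).integerHull) :
    ∑ r, (inst h).profit r * x r ≤ 2 := by
  have hconv : Convex ℝ {x : Node h → ℝ | ∑ r, (inst h).profit r * x r ≤ 2} := by
    refine convex_halfSpace_le ⟨fun x y => ?_, fun c x => ?_⟩ 2
    · simp [mul_add, sum_add_distrib]
    · simp [mul_sum, mul_left_comm]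
  refine convexHull_min ?_ hconv hx
  rintro y ⟨hy, hy'⟩
  have := subtreeSum_profit_mul_le hy'
    (fun n => hy.2 _ (by rw [show (inst h).graph = tree h from rfl, tree_edgeSet]; exact ⟨n, rfl⟩))
    []
  simpa [subtreeSum_nil] using this

theorem integerHull_profit_le_two :
    sSup ((fun x => ∑ r, (inst h).profit r * x r) '' (inst h).integerHull) ≤ 2 :=
  Real.sSup_le (by rintro _ ⟨x, hx, rfl⟩; exact profit_le_two_of_mem_integerHull hx) two_pos.le

/-- Selecting only the request of the child of the root gives profit `1`. -/
theorem integerHull_profit_pos (hh : 0 < h) :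
    0 < sSup ((fun x => ∑ r, (inst h).profit r * x r) '' (inst h).integerHull) := by
  let n : Node h := ⟨[], hh⟩
  have hmem : ind ((({n} : Finset (Node h))) : Set (Node h)) ∈ (inst h).integerHull := by
    refine ind_mem_knapsackHull fun e he => ?_
    obtain ⟨m, rfl⟩ : e ∈ Set.range fun n : Node h => s(some n, parent n) := by
      rw [← tree_edgeSet]
      exact he
    refine load_ind_le_of_mod_eq (q := 1) (i := 0) le_rfl (fun r _ => Nat.mod_one _)
      (fun m _ => ?_) m
    exact (card_le_card (filter_subset _ _)).trans (by simp)
  refine lt_of_lt_of_le ?_ (le_csSup ⟨2, ?_⟩ ⟨_, hmem, rfl⟩)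
  · simp [ind, profit_eq, n]
  · rintro _ ⟨x, hx, rfl⟩
    exact profit_le_two_of_mem_integerHull hx

/-! ### The number of edges and the integrality gap -/

theorem numEdges_eq (h : ℕ) : (inst h).numEdges = Fintype.card (Node h) := by
  unfold ANFTree.numEdges
  rw [show (inst h).graph = tree h from rfl, tree_edgeSet, ← Set.image_univ,
    Set.ncard_image_of_injective _ (edge_injective h), Set.ncard_univ, Nat.card_eq_fintype_card]

theorem le_card_node (h : ℕ) : h ≤ Fintype.card (Node h) := by
  have h1 : ∑ r, (inst h).profit r ≤ Fintype.card (Node h) • (1 : ℝ) := by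
    refine sum_le_card_nsmul _ _ _ fun r _ => ?_
    rw [profit_eq]
    exact inv_le_one_of_one_le₀ (one_le_pow₀ one_le_two)
  rw [sum_profit, nsmul_eq_mul, mul_one] at h1
  exact_mod_cast h1

theorem card_node_le (hh : 1 ≤ h) : Fintype.card (Node h) ≤ 2 ^ (h * h) := by
  have h1 : Fintype.card (Node h) • ((2 : ℝ) ^ ((h - 1) * (h - 1)))⁻¹ ≤
      ∑ r, (inst h).profit r := by
    refine card_nsmul_le_sum _ _ _ fun r _ => ?_
    rw [profit_eq]
    refine inv_anti₀ (by positivity) (pow_le_pow_right₀ one_le_two (Nat.mul_le_mul_left _ ?_))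
    have := r.2
    omega
  rw [sum_profit, nsmul_eq_mul, ← div_eq_mul_inv, div_le_iff₀ (by positivity)] at h1
  have h2 : Fintype.card (Node h) ≤ h * 2 ^ ((h - 1) * (h - 1)) := by exact_mod_cast h1
  refine h2.trans ?_
  calc h * 2 ^ ((h - 1) * (h - 1)) ≤ 2 ^ h * 2 ^ ((h - 1) * (h - 1)) :=
        Nat.mul_le_mul_right _ Nat.lt_two_pow_self.le
    _ = 2 ^ (h + (h - 1) * (h - 1)) := (pow_add ..).symm
    _ ≤ 2 ^ (h * h) := by
      refine Nat.pow_le_pow_right two_pos ?_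
      obtain ⟨m, rfl⟩ := Nat.exists_eq_add_of_le' hh
      simp only [Nat.add_sub_cancel]
      nlinarith

/-- Vectors of `P^t` lie in the cube. This needs `t ≤ m`: for larger `t` the intersection
defining `P^t` is over no sets at all. -/
theorem le_one_of_mem_level {t : ℕ} (ht : t ≤ (inst h).numEdges) {x : Node h → ℝ}
    (hx : x ∈ (inst h).level t) (r : Node h) : x r ≤ 1 := by
  classical
  obtain ⟨A, -, hA⟩ := exists_subset_card_eq (n := t) (s := (univ : Finset (Node h)))
    (by rw [card_univ, ← numEdges_eq]; exact ht)
  have h1 := hx (A.image fun n => s(some n, parent n))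
    (by
      rw [show (inst h).graph = tree h from rfl, tree_edgeSet]
      intro e he
      simp only [coe_image, Set.mem_image] at he
      obtain ⟨n, -, rfl⟩ := he
      exact ⟨n, rfl⟩)
    (by rw [card_image_of_injective _ (edge_injective h), hA])
  have hconv : Convex ℝ {x : Node h → ℝ | x r ≤ 1} :=
    convex_halfSpace_le ⟨fun x y => rfl, fun c x => rfl⟩ 1
  exact convexHull_min (fun y hy => (hy.1.1 r).2) hconv h1

/-! ### The integrality gap -/

/-- A subset of `P^t` containing the constant vector `1 / (q + 1)`, which has profit
`h / (q + 1)`, has integrality gap at least half of that profit. -/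
theorem le_integralityGap (hh : 0 < h) {t q : ℕ} (ht : t ≤ (inst h).numEdges)
    {Q : Set (Node h → ℝ)} (hQ : Q ⊆ (inst h).level t)
    (hmem : (fun _ => 1 / ((q : ℝ) + 1)) ∈ Q) :
    (h : ℝ) / (q + 1) / 2 ≤ (inst h).integralityGap Q := by
  have h1 : (h : ℝ) / (q + 1) ≤ sSup ((fun x => ∑ r, (inst h).profit r * x r) '' Q) := by
    refine le_csSup ⟨h, ?_⟩ ⟨_, hmem, ?_⟩
    · rintro _ ⟨x, hx, rfl⟩
      rw [← sum_profit h]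
      exact sum_le_sum fun r _ =>
        mul_le_of_le_one_right ((inst h).profit_nonneg r) (le_one_of_mem_level ht (hQ hx) r)
    · simp only
      rw [← sum_mul, sum_profit, mul_one_div]
  have h2 : (0 : ℝ) ≤ (h : ℝ) / (q + 1) := by positivity
  exact div_le_div₀ (h2.trans h1) h1 (integerHull_profit_pos hh) integerHull_profit_le_two

theorem sqrt_log_numRequests_le (hh : 1 ≤ h) :
    √(Real.log ((inst h).numRequests : ℝ)) ≤ h := by
  refine Real.sqrt_le_iff.2 ⟨by positivity, ?_⟩
  have hpos : 0 < Fintype.card (Node h) := hh.trans (le_card_node h)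
  have h1 : ((inst h).numRequests : ℝ) ≤ 2 ^ (h * h) := by exact_mod_cast card_node_le hh
  have h2 := Real.log_le_log (by unfold ANFTree.numRequests; exact_mod_cast hpos) h1
  rw [Real.log_pow] at h2
  push_cast at h2
  nlinarith [Real.log_two_lt_d9, mul_nonneg (Nat.cast_nonneg (α := ℝ) h) (Nat.cast_nonneg h)]

theorem ceil_numRequests_rpow_le (hh : 1 ≤ h) {c : ℝ} (hc : 0 < c) :
    ⌈((inst h).numRequests : ℝ) ^ c⌉₊ ≤ 2 ^ (h * ⌈c * h⌉₊) := by
  refine Nat.ceil_le.2 ?_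
  have h1 : ((inst h).numRequests : ℝ) ≤ 2 ^ (h * h) := by exact_mod_cast card_node_le hh
  calc ((inst h).numRequests : ℝ) ^ c ≤ ((2 : ℝ) ^ (h * h)) ^ c :=
        Real.rpow_le_rpow (Nat.cast_nonneg _) h1 hc.le
    _ = (2 : ℝ) ^ ((h : ℝ) * (c * h)) := by
        rw [← Real.rpow_natCast, ← Real.rpow_mul two_pos.le]
        push_cast
        ring_nf
    _ ≤ (2 : ℝ) ^ ((h : ℝ) * ⌈c * h⌉₊) :=
        Real.rpow_le_rpow_of_exponent_le one_le_two
          (mul_le_mul_of_nonneg_left (Nat.le_ceil _) (Nat.cast_nonneg _))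
    _ = ((2 ^ (h * ⌈c * h⌉₊) : ℕ) : ℝ) := by
        push_cast
        rw [← Real.rpow_natCast]
        push_cast
        rfl

end FriggstadGao

theorem mainTheorem2 :
    ∃ C : ℝ, 0 < C ∧
      (∀ t : ℕ, 1 ≤ t → ∃ h₀ : ℕ, ∀ h : ℕ, h₀ ≤ h → 2 ≤ h →
        C * √(Real.log ((FriggstadGao.inst h).numRequests : ℝ)) ≤
          (FriggstadGao.inst h).integralityGap ((FriggstadGao.inst h).levelRank t)) ∧
      (∀ c : ℝ, 0 < c → ∃ h₀ : ℕ, ∀ h : ℕ, h₀ ≤ h → 2 ≤ h →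
        ∀ t : ℕ, t = min ⌈((FriggstadGao.inst h).numRequests : ℝ) ^ c⌉₊
            (FriggstadGao.inst h).numEdges →
          C / c ≤ (FriggstadGao.inst h).integralityGap ((FriggstadGao.inst h).level t) ∧
          C / c ≤ (FriggstadGao.inst h).integralityGap ((FriggstadGao.inst h).levelRank t)) := by
  open FriggstadGao in
  refine ⟨1 / 6, by norm_num, fun t _ => ⟨max t 4, fun h hh _ => ?_⟩,
    fun c hc => ⟨max ⌈4 / c⌉₊ 4, fun h hh _ t ht => ?_⟩⟩
  · -- Three classes (`q = 2`) suffice as soon as `t ≤ 2 ^ h`.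
    have hh4 : 4 ≤ h := (le_max_right _ _).trans hh
    have hth : t ≤ h := (le_max_left _ _).trans hh
    have hgap := le_integralityGap (h := h) (Q := (inst h).levelRank t) (t := t) (q := 2) (by omega)
      (by rw [numEdges_eq]; exact hth.trans (le_card_node h)) Set.inter_subset_left
      (const_mem_levelRank hh4 le_rfl (by simpa using hth.trans Nat.lt_two_pow_self.le))
    have := sqrt_log_numRequests_le (h := h) (by omega)
    push_cast at hgap
    linarith
  · have hh4 : 4 ≤ h := (le_max_right _ _).trans hh
    -- With this many classes, `t ≤ k ^ c ≤ 2 ^ (h * ⌈c * h⌉)` is within the admissible range.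
    set q := ⌈c * h⌉₊ + 2 with hq
    have htm : t ≤ (inst h).numEdges := ht ▸ min_le_right _ _
    have htq : t ≤ 2 ^ (h * (q - 1)) := calc
      t ≤ ⌈((inst h).numRequests : ℝ) ^ c⌉₊ := ht ▸ min_le_left _ _
      _ ≤ 2 ^ (h * ⌈c * h⌉₊) := ceil_numRequests_rpow_le (by omega) hc
      _ ≤ 2 ^ (h * (q - 1)) :=
        Nat.pow_le_pow_right two_pos (Nat.mul_le_mul_left _ (by omega))
    have hch : 4 ≤ c * h := by
      have h1 : 4 / c ≤ h := Nat.ceil_le.1 ((le_max_left _ _).trans hh)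
      rwa [div_le_iff₀' hc] at h1
    have hbound : 1 / 6 / c ≤ (h : ℝ) / (q + 1) / 2 := by
      have h1 : (q : ℝ) + 1 ≤ 2 * (c * h) := by
        have := Nat.ceil_lt_add_one (show 0 ≤ c * (h : ℝ) by positivity)
        rw [hq]
        push_cast
        linarith
      rw [div_div, div_div, div_le_div_iff₀ (by positivity) (by positivity)]
      nlinarith
    exact ⟨hbound.trans (le_integralityGap (by omega) htm subset_rfl
        (const_mem_level (by omega) htq)),
      hbound.trans (le_integralityGap (by omega) htm Set.inter_subset_left
        (const_mem_levelRank hh4 (by omega) htq))⟩
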